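/- Let $E$ be a set and identify a bipartition $(A, E\setminus A)$ of $E$ with the subset $A$. Two subsets $A,B$ of $E$ are \emph{nested} if $A\subseteq B$, $B\subseteq A$, $A\cap B=\emptyset$ or $A\cup B=E$; otherwise they \emph{cross}. Let $\mathcal{B}$ be a set of subsets of $E$, each different from $\emptyset$ and $E$, such that $\mathcal{B}$ is closed under complements and such that $S\cup T\in\mathcal{B}$ for all crossing $S,T\in\mathcal{B}$. Let $\mathcal{E}$ be the set of elements of $\mathcal{B}$ that cross no element of $\mathcal{B}$, and let $\mathcal{V}$ be the finest partition of $\mathcal{B}\setminus\mathcal{E}$ such that elements of distinct partition classes are nested. For a set $S$ of subsets of $E$ let $\partial(S)$ be the set of equivalence classes of the relation on $E$ under which $e$ and $f$ are equivalent if every $A\in S$ contains either both or neither of $e,f$. Let the \emph{closure} $\mathrm{cl}(S)$ be the set of those elements of $\mathcal{B}$ that are unions of elements of $\partial(S)$. An \emph{interval} of a cyclically ordered set $X$ is a subset that contains, with any two of its points $x,y$, all points strictly between $x$ and $y$ or all points strictly between $y$ and $x$; it is \emph{non-trivial} if it is neither $\emptyset$ nor $X$. (All cyclic orders are total.) A \emph{pre-flower}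 is a finite subset $\mathcal{F}$ of $\mathcal{B}$ with at least two elements such that for all $S,T\in\mathcal{F}$ there are $R_0,\dots,R_n\in\mathcal{F}$ with $R_0=S$, $R_n=T$ such that $R_i$ and $R_{i+1}$ cross for $0\le i\le n-1$. A \emph{pre-daisy} is a pre-flower $\mathcal{F}$ for which there is a cyclic order on $\partial(\mathcal{F})$ such that the elements of $\mathrm{cl}(\mathcal{F})$ are exactly the unions of non-trivial intervals of $\partial(\mathcal{F})$. Let $V\in\mathcal{V}$ be such that every pre-flower $\mathcal{F}\subseteq V$ is a pre-daisy. Then there is a cyclic order on $\partial(V)$ such that every element of $\mathrm{cl}(V)$ is the union of an interval of $\partial(V)$, and this cyclic order is unique up to mirroring: every cyclic order on $\partial(V)$ with this property equals it or its reverse. -/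

import Mathlib

/-! A bipartition `(A, E \ A)` of the ground set `E` is represented by its first side `A : Set E`;
the inverse of `A` is `Aᶜ`. -/

namespace BipartitionSystem

variable {E : Type*}

/-- Two (oriented) bipartitions are nested if some orientations of them are comparable. -/
def Nested (A B : Set E) : Prop :=
  A ⊆ B ∨ A ∩ B = ∅ ∨ B ⊆ A ∨ A ∪ B = Set.univ

/-- Two bipartitions cross if they are not nested. -/
def Crosses (A B : Set E) : Prop := ¬ Nested A B

/-- The elements of `𝓑` that cross no element of `𝓑`. -/
def uncrossed (𝓑 : Set (Set E)) : Set (Set E) :=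
  {S | S ∈ 𝓑 ∧ ∀ T ∈ 𝓑, Nested S T}

/-- The finest equivalence relation on the elements of `𝓑` that cross some element of `𝓑` such that
crossing elements are equivalent. (In the order on `Setoid`, finer relations are smaller.) -/
def crossingSetoid (𝓑 : Set (Set E)) : Setoid ↥(𝓑 \ uncrossed 𝓑) :=
  sInf {r | ∀ S T : ↥(𝓑 \ uncrossed 𝓑), Crosses (S : Set E) (T : Set E) → r S T}

/-- The finest partition of `𝓑 \ uncrossed 𝓑` such that elements of distinct partition classes are
nested; its elements are the crossing classes of `𝓑`. -/
def crossingClasses (𝓑 : Set (Set E)) : Set (Set (Set E)) :=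
  {V | ∃ C ∈ (crossingSetoid 𝓑).classes, V = Subtype.val '' C}

/-- A pre-flower of `𝓑`: a finite subset of `𝓑` with at least two elements, any two of which are
linked by a finite sequence in the subset whose consecutive elements cross. -/
def IsPreFlower (𝓑 F : Set (Set E)) : Prop :=
  F ⊆ 𝓑 ∧ F.Finite ∧ F.Nontrivial ∧
    ∀ S ∈ F, ∀ T ∈ F, Relation.ReflTransGen (fun R R' => R ∈ F ∧ R' ∈ F ∧ Crosses R R') S T

/-- `e` and `f` are equivalent if no element of `S` distinguishes them. -/
def indistinguishable (S : Set (Set E)) : Setoid E where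
  r e f := ∀ A ∈ S, e ∈ A ↔ f ∈ A
  iseqv :=
    { refl := fun _ _ _ => Iff.rfl
      symm := fun h A hA => (h A hA).symm
      trans := fun h h' A hA => (h A hA).trans (h' A hA) }

/-- `∂(S)`: the set of equivalence classes of `indistinguishable S`. -/
def boundary (S : Set (Set E)) : Set (Set E) := (indistinguishable S).classes

/-- The closure of `S` in `𝓑`: the elements of `𝓑` that are unions of elements of `∂(S)`. -/
def sepClosure (𝓑 S : Set (Set E)) : Set (Set E) :=
  {A | A ∈ 𝓑 ∧ ∃ C : Set (Set E), C ⊆ boundary S ∧ A = ⋃₀ C}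

/-- Intervals of a cyclically ordered set `X`: with any two points they contain one of the two arcs
between these points. These are `∅`, `X`, and the sets of points between two cuts of `X`; an
interval need not have end points in `X`. -/
def IsInterval {X : Type*} (c : CircularOrder X) (I : Set X) : Prop :=
  ∀ x ∈ I, ∀ y ∈ I, (∀ z, c.sbtw x z y → z ∈ I) ∨ (∀ z, c.sbtw y z x → z ∈ I)

/-- A pre-daisy of `𝓑`: a pre-flower `F` such that, for some cyclic order on `∂(F)`, the elements of
its closure are exactly the unions of non-trivial intervals of `∂(F)`. -/
def IsPreDaisy (𝓑 F : Set (Set E)) : Prop :=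
  IsPreFlower 𝓑 F ∧ ∃ c : CircularOrder ↥(boundary F), ∀ A : Set E,
    A ∈ sepClosure 𝓑 F ↔
      ∃ I : Set ↥(boundary F), IsInterval c I ∧ I ≠ ∅ ∧ I ≠ Set.univ ∧ A = ⋃ P ∈ I, (P : Set E)

/-- Every element of the closure of `V` is the union of an interval of the cyclic order `c`. -/
def Displays (𝓑 V : Set (Set E)) (c : CircularOrder ↥(boundary V)) : Prop :=
  ∀ A ∈ sepClosure 𝓑 V, ∃ I : Set ↥(boundary V), IsInterval c I ∧ A = ⋃ P ∈ I, (P : Set E)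

end BipartitionSystem

/-! Whether a set is an interval depends only on the cyclic order of quadruples of points, so both
parts of the theorem can be tested on pre-daisies in `V` that distinguish finitely many given
points. Every finite subset of the crossing class `V` lies in such a pre-daisy, because `V` is
connected in the graph of crossings.

Existence is compactness: take an ultrafilter on the pre-daisies in `V` that eventually contains
each element of `V`, and order `∂(V)` by the limit of the cyclic orders of the pre-daisies. If the
limit did not display some `A` in the closure of `V`, then in a large pre-daisy `F` four points
would alternate between `A` and its complement. An arc of `∂(F)` that contains two consecutive ones
of these points crosses `A`, and it also crosses an element of `F`. Hence `A ∈ V`, so that `A`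
belongs to a larger pre-daisy, whose order displays `A`: a contradiction.

For uniqueness, any order that displays `V` makes intervals of the arcs of a pre-daisy. Two triples
that are equally oriented in the pre-daisy are linked by steps that move a single point within an
arc avoiding the other two, so they are also equally oriented in the displaying order. -/

namespace BipartitionSystem

section CircularOrder

open Set Filter

variable {X : Type*} [o : CircularOrder X]

theorem sbtw_or_sbtw_iff {a b c : X} : sbtw a b c ∨ sbtw c b a ↔ a ≠ b ∧ b ≠ c ∧ c ≠ a := by
  constructor
  · rintro (h | h) <;> refine ⟨?_, ?_, ?_⟩ <;> rintro rfl <;>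
      simp_all only [sbtw_irrefl_left, sbtw_irrefl_right, sbtw_irrefl_left_right]
  · rintro ⟨hab, hbc, hca⟩
    by_contra! h
    rcases (btw_iff_not_sbtw.2 h.2).antisymm (btw_iff_not_sbtw.2 h.1) with h | h | h
    exacts [hab h, hbc h, hca h]

theorem sbtw_or_sbtw_of_ne_left {a b c d : X} (h : sbtw a b c) (hd : d ≠ a) :
    sbtw a d c ∨ sbtw a b d := by
  by_cases hdc : d = c
  · exact .inr (hdc ▸ h)
  · have hca := (sbtw_or_sbtw_iff.1 (.inl h)).2.2
    exact (sbtw_or_sbtw_iff.2 ⟨hd.symm, hdc, hca⟩).imp_right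
      fun hcda => h.trans_right hcda.cyclic_right

theorem isInterval_cIoo (a b : X) : IsInterval o (cIoo a b) := by
  have between_subset : ∀ {x y}, sbtw a x y → sbtw a y b → ∀ z, sbtw x z y → sbtw a z b :=
    fun hxy hy z hz => (hxy.trans_left hz).trans_right hy
  intro x hx y hy
  by_cases hxy : x = y
  · exact .inl fun z hz => absurd (hxy ▸ hz) sbtw_irrefl_left_right
  · have hax := (sbtw_or_sbtw_iff.1 (.inl hx)).1
    have hay := (sbtw_or_sbtw_iff.1 (.inl hy)).1
    exact (sbtw_or_sbtw_iff.2 ⟨hax, hxy, hay.symm⟩).imp (between_subset · hy)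
      fun h => between_subset h.cyclic_right hx

theorem forall_sbtw_of_move {α : Type*} {π : α → X} {p : α → α → α → Prop}
    (rotate : ∀ {x y z}, p x y z → p y z x)
    (move : ∀ {x y z w}, sbtw (π x) (π y) (π z) → sbtw (π x) (π y) (π w) → p x y z → p x y w)
    {a b c x y z : α} (habc : sbtw (π a) (π b) (π c)) (hxyz : sbtw (π x) (π y) (π z))
    (h : p a b c) : p x y z := by
  have move_mid : ∀ {x y z w}, sbtw (π x) (π y) (π z) → sbtw (π x) (π w) (π z) →
      p x y z → p x w z := fun hy hw h =>
    rotate (move hy.cyclic_right hw.cyclic_right (rotate (rotate h)))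
  have exists_fst_eq : ∃ b' c', sbtw (π x) (π b') (π c') ∧ p x b' c' := by
    by_cases hxa : π x = π a
    · rw [← hxa] at habc
      exact ⟨b, c, habc, rotate (rotate (move (hxa ▸ habc.cyclic_left) habc.cyclic_left
        (rotate h)))⟩
    · rcases sbtw_or_sbtw_of_ne_left habc hxa with hx | hx
      · exact ⟨c, a, hx.cyclic_left, rotate (move_mid habc hx h)⟩
      · exact ⟨a, b, hx.cyclic_right, rotate (rotate (move habc hx h))⟩
  obtain ⟨b', c', hx, hp⟩ := exists_fst_eq
  have hxy := (sbtw_or_sbtw_iff.1 (.inl hxyz)).1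
  rcases sbtw_or_sbtw_of_ne_left hx hxy.symm with hy | hy
  · exact move hy hxyz (move_mid hx hy hp)
  · have hz := hy.trans_right hxyz
    exact move_mid hz hxyz (move hx hz hp)

/-- The limit of cyclic orders on the spaces `Y i` along an ultrafilter, as a cyclic order on a type
whose points are eventually separated by the maps to the spaces `Y i`. -/
@[reducible] def ultralimitOrder {ι α : Type*} {Y : ι → Type*} (U : Ultrafilter ι)
    [∀ i, CircularOrder (Y i)] (π : ∀ i, α → Y i)
    (hπ : ∀ a b, a ≠ b → ∀ᶠ i in U, π i a ≠ π i b) : CircularOrder α where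
  btw a b c := ∀ᶠ i in U, btw (π i a) (π i b) (π i c)
  sbtw a b c := ∀ᶠ i in U, sbtw (π i a) (π i b) (π i c)
  btw_refl a := .of_forall fun i => btw_refl (π i a)
  btw_cyclic_left h := h.mono fun _ => btw_cyclic_left
  sbtw_trans_left h h' := h'.mp (h.mono fun _ => sbtw_trans_left)
  sbtw_iff_btw_not_btw := by
    simp only [← Ultrafilter.eventually_not, ← eventually_and, sbtw_iff_btw_not_btw, implies_true]
  btw_antisymm {a b c} h h' := by
    by_contra! hne
    obtain ⟨i, habc, hcba, hab, hbc, hca⟩ :=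
      (h.and (h'.and ((hπ _ _ hne.1).and ((hπ _ _ hne.2.1).and (hπ _ _ hne.2.2))))).exists
    rcases habc.antisymm hcba with h | h | h
    exacts [hab h, hbc h, hca h]
  btw_total a b c := Ultrafilter.eventually_or.1 (.of_forall fun i => btw_total _ _ _)

theorem sbtw_or_reverse_of_sbtw {Y : Type*} {o : CircularOrder Y} (o' : CircularOrder Y)
    {a b c : Y} (h : o.sbtw a b c) : o'.sbtw a b c ∨ o'.sbtw c b a :=
  (@sbtw_or_sbtw_iff Y o' a b c).2 ((@sbtw_or_sbtw_iff Y o a b c).1 (.inl h))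

end CircularOrder

variable {E : Type*}

section Boundary

variable {𝓑 F S V : Set (Set E)} {x y z w p q r : E}

/-- The element of `∂(S)` that contains the point `x`. -/
def toBoundary (S : Set (Set E)) (x : E) : ↥(boundary S) :=
  ⟨{y | indistinguishable S y x}, Setoid.mem_classes _ x⟩

theorem mem_toBoundary (S : Set (Set E)) (x : E) : x ∈ (toBoundary S x : Set E) :=
  (indistinguishable S).refl x

theorem eq_toBoundary_of_mem {P : ↥(boundary S)} (hx : x ∈ (P : Set E)) : P = toBoundary S x :=
  Subtype.ext (Setoid.eq_of_mem_classes P.2 hx (toBoundary S x).2 (mem_toBoundary S x))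

theorem toBoundary_eq_iff : toBoundary S x = toBoundary S y ↔ ∀ A ∈ S, x ∈ A ↔ y ∈ A :=
  ⟨fun h => (h ▸ mem_toBoundary S x : x ∈ (toBoundary S y : Set E)),
    fun h => eq_toBoundary_of_mem (P := toBoundary S x) (fun A hA => (h A hA).symm)⟩

theorem toBoundary_surjective (S : Set (Set E)) : Function.Surjective (toBoundary S) := by
  rintro ⟨_, x, rfl⟩
  exact ⟨x, rfl⟩

theorem toBoundary_eq_of_subset (hFV : F ⊆ V) (h : toBoundary V x = toBoundary V y) :
    toBoundary F x = toBoundary F y :=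
  toBoundary_eq_iff.2 fun A hA => toBoundary_eq_iff.1 h A (hFV hA)

theorem exists_boundary_map (hFV : F ⊆ V) :
    ∃ π : ↥(boundary V) → ↥(boundary F), ∀ x, π (toBoundary V x) = toBoundary F x :=
  ⟨fun P => toBoundary F (Function.surjInv (toBoundary_surjective V) P),
    fun _ => toBoundary_eq_of_subset hFV (Function.surjInv_eq _ _)⟩

theorem biUnion_boundary_eq_preimage (I : Set ↥(boundary S)) :
    ⋃ P ∈ I, (P : Set E) = toBoundary S ⁻¹' I := by
  ext x
  simp only [Set.mem_iUnion, exists_prop, Set.mem_preimage]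
  exact ⟨fun ⟨P, hP, hx⟩ => eq_toBoundary_of_mem hx ▸ hP, fun h => ⟨_, h, mem_toBoundary S x⟩⟩

theorem mem_sepClosure_iff {A : Set E} : A ∈ sepClosure 𝓑 S ↔
    A ∈ 𝓑 ∧ ∀ x y, toBoundary S x = toBoundary S y → x ∈ A → y ∈ A := by
  refine and_congr_right fun _ => ⟨?_, fun h => ⟨{P ∈ boundary S | P ⊆ A}, fun P hP => hP.1, ?_⟩⟩
  · rintro ⟨C, hC, rfl⟩ x y hxy ⟨P, hP, hx⟩
    have hPx : P = toBoundary S x :=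
      congrArg Subtype.val (eq_toBoundary_of_mem (P := ⟨P, hC hP⟩) hx)
    exact ⟨P, hP, hPx ▸ hxy ▸ mem_toBoundary S y⟩
  · refine subset_antisymm (fun x hx => ?_) (Set.sUnion_subset fun P hP => hP.2)
    exact ⟨toBoundary S x, ⟨(toBoundary S x).2, fun y hy => h x y (eq_toBoundary_of_mem hy) hx⟩,
      mem_toBoundary S x⟩

theorem sepClosure_mono (hFV : F ⊆ V) : sepClosure 𝓑 F ⊆ sepClosure 𝓑 V := fun _ hA =>
  mem_sepClosure_iff.2 ((mem_sepClosure_iff.1 hA).imp_right fun h x y hxy =>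
    h x y (toBoundary_eq_of_subset hFV hxy))

theorem subset_sepClosure (hF : F ⊆ 𝓑) : F ⊆ sepClosure 𝓑 F := fun A hA =>
  mem_sepClosure_iff.2 ⟨hF hA, fun _ _ hxy => (toBoundary_eq_iff.1 hxy A hA).1⟩

theorem displays_iff {c : CircularOrder ↥(boundary S)} : Displays 𝓑 S c ↔
    ∀ A ∈ sepClosure 𝓑 S, ∀ x ∈ A, ∀ y ∈ A, ∀ z w,
      sbtw (toBoundary S x) (toBoundary S z) (toBoundary S y) →
      sbtw (toBoundary S y) (toBoundary S w) (toBoundary S x) → z ∈ A ∨ w ∈ A := by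
  refine forall₂_congr fun A hA => ⟨?_, fun h => ?_⟩
  · rintro ⟨I, hI, rfl⟩ x hx y hy z w hz hw
    rw [biUnion_boundary_eq_preimage] at hx hy ⊢
    exact (hI _ hx _ hy).imp (· _ hz) (· _ hw)
  · have preimage_image : A = toBoundary S ⁻¹' (toBoundary S '' A) :=
      (Set.subset_preimage_image _ _).antisymm
        fun y ⟨x, hx, hxy⟩ => (mem_sepClosure_iff.1 hA).2 x y hxy hx
    refine ⟨toBoundary S '' A, ?_, preimage_image.trans (biUnion_boundary_eq_preimage _).symm⟩
    rintro _ ⟨x, hx, rfl⟩ _ ⟨y, hy, rfl⟩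
    by_contra! hne
    obtain ⟨⟨Z, hZ, hZA⟩, W, hW, hWA⟩ := hne
    obtain ⟨z, rfl⟩ := toBoundary_surjective S Z
    obtain ⟨w, rfl⟩ := toBoundary_surjective S W
    exact (h x hx y hy z w hZ hW).elim (fun hz => hZA ⟨z, hz, rfl⟩) fun hw => hWA ⟨w, hw, rfl⟩

theorem Displays.sbtw_of_mem {c : CircularOrder ↥(boundary S)} (hc : Displays 𝓑 S c) {A : Set E}
    (hA : A ∈ sepClosure 𝓑 S) (hx : x ∉ A) (hy : y ∉ A) (hz : z ∈ A) (hw : w ∈ A)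
    (h : sbtw (toBoundary S x) (toBoundary S y) (toBoundary S z)) :
    sbtw (toBoundary S x) (toBoundary S y) (toBoundary S w) := by
  have ne_of_mem : ∀ {u v}, u ∉ A → v ∈ A → toBoundary S v ≠ toBoundary S u := fun hu hv huv =>
    hu ((mem_sepClosure_iff.1 hA).2 _ _ huv hv)
  have hyx := (sbtw_or_sbtw_iff.1 (.inl h)).1
  rcases sbtw_or_sbtw_iff.2 ⟨hyx, (ne_of_mem hy hw).symm, ne_of_mem hx hw⟩ with hxyw | hwyx
  · exact hxyw
  · -- Here `x` and `y` alternate with `z` and `w`.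
    have hzxw := (hwyx.cyclic_right.trans_right h).cyclic_right
    have hwyz := (h.cyclic_left.trans_right hwyx.cyclic_left).cyclic_right
    exact ((displays_iff.1 hc A hA z hz w hw x y hzxw hwyz).elim hx hy).elim

/-- A cyclic order on `∂(F)` that witnesses that a pre-flower `F` is a pre-daisy. -/
def IsDaisyOrder (𝓑 F : Set (Set E)) (c : CircularOrder ↥(boundary F)) : Prop :=
  ∀ A : Set E, A ∈ sepClosure 𝓑 F ↔
    ∃ I : Set ↥(boundary F), IsInterval c I ∧ I ≠ ∅ ∧ I ≠ Set.univ ∧ A = ⋃ P ∈ I, (P : Set E)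

theorem IsDaisyOrder.displays {c : CircularOrder ↥(boundary F)} (hc : IsDaisyOrder 𝓑 F c) :
    Displays 𝓑 F c := fun A hA =>
  let ⟨I, hI, _, _, hAI⟩ := (hc A).1 hA
  ⟨I, hI, hAI⟩

theorem IsDaisyOrder.arc_mem_sepClosure {c : CircularOrder ↥(boundary F)}
    (hc : IsDaisyOrder 𝓑 F c) {P Q R : ↥(boundary F)} (hPQR : sbtw P Q R) :
    toBoundary F ⁻¹' Set.cIoo P R ∈ sepClosure 𝓑 F := by
  refine (hc _).2 ⟨Set.cIoo P R, isInterval_cIoo P R, Set.Nonempty.ne_empty ⟨Q, hPQR⟩, ?_,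
    (biUnion_boundary_eq_preimage _).symm⟩
  exact (Set.ne_univ_iff_exists_notMem _).2 ⟨P, sbtw_irrefl_left⟩

theorem IsDaisyOrder.sbtw_of_displays {c : CircularOrder ↥(boundary F)}
    {c' : CircularOrder ↥(boundary V)} (hc : IsDaisyOrder 𝓑 F c) (hc' : Displays 𝓑 V c')
    (hFV : F ⊆ V) (hpqr : sbtw (toBoundary F p) (toBoundary F q) (toBoundary F r))
    (hxyz : sbtw (toBoundary F x) (toBoundary F y) (toBoundary F z))
    (h : sbtw (toBoundary V p) (toBoundary V q) (toBoundary V r)) :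
    sbtw (toBoundary V x) (toBoundary V y) (toBoundary V z) := by
  refine forall_sbtw_of_move (π := toBoundary F)
    (p := fun x y z => sbtw (toBoundary V x) (toBoundary V y) (toBoundary V z))
    sbtw_cyclic_left (fun {x y z w} hz hw => ?_) hpqr hxyz h
  exact hc'.sbtw_of_mem (sepClosure_mono hFV (hc.arc_mem_sepClosure hz.cyclic_left))
    sbtw_irrefl_right sbtw_irrefl_left hz.cyclic_left hw.cyclic_left

theorem IsDaisyOrder.not_sbtw_of_displays {c : CircularOrder ↥(boundary F)}
    {c' : CircularOrder ↥(boundary V)} (hc : IsDaisyOrder 𝓑 F c) (hc' : Displays 𝓑 V c')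
    (hFV : F ⊆ V) (hpqr : sbtw (toBoundary F p) (toBoundary F q) (toBoundary F r))
    (hxyz : sbtw (toBoundary F x) (toBoundary F y) (toBoundary F z))
    (h : sbtw (toBoundary V p) (toBoundary V q) (toBoundary V r)) :
    ¬ sbtw (toBoundary V z) (toBoundary V y) (toBoundary V x) :=
  (hc.sbtw_of_displays hc' hFV hpqr hxyz h).not_sbtw

end Boundary

section Crossing

variable {𝓑 F V : Set (Set E)} {A B K S T : Set E}

theorem Nested.symm (h : Nested A B) : Nested B A := by
  unfold Nested at *
  rw [Set.inter_comm, Set.union_comm]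
  tauto

theorem Crosses.symm (h : Crosses A B) : Crosses B A := fun hn => h hn.symm

theorem crosses_iff : Crosses A B ↔
    (A \ B).Nonempty ∧ (A ∩ B).Nonempty ∧ (B \ A).Nonempty ∧ (A ∪ B)ᶜ.Nonempty := by
  rw [Set.sdiff_nonempty, Set.sdiff_nonempty, Set.nonempty_compl, Set.nonempty_iff_ne_empty]
  simp only [Crosses, Nested, not_or, ne_eq]

/-- One of the two sides of the bipartition `A` is contained in `K`. -/
def HasSideIn (A K : Set E) : Prop := A ⊆ K ∨ Aᶜ ⊆ K

theorem nested_iff_hasSideIn : Nested A K ↔ HasSideIn A K ∨ HasSideIn A Kᶜ := by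
  rw [HasSideIn, HasSideIn, Nested, ← Set.disjoint_iff_inter_eq_empty,
    ← Set.subset_compl_iff_disjoint_right, Set.compl_subset_compl, Set.compl_subset_iff_union]
  tauto

theorem HasSideIn.nested (hA : HasSideIn A K) (hB : HasSideIn B Kᶜ) : Nested A B := by
  have subset_compl : ∀ {C D : Set E}, C ⊆ K → D ⊆ Kᶜ → C ⊆ Dᶜ := fun hC hD =>
    hC.trans (Set.subset_compl_comm.1 hD)
  rw [nested_iff_hasSideIn]
  rcases hA with hA | hA <;> rcases hB with hB | hB
  · exact .inr (.inl (subset_compl hA hB))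
  · exact .inl (.inl (by simpa only [compl_compl] using subset_compl hA hB))
  · exact .inr (.inr (subset_compl hA hB))
  · exact .inl (.inr (by simpa only [compl_compl] using subset_compl hA hB))

theorem HasSideIn.mem_iff_mem (hA : HasSideIn A K) {x y : E} (hx : x ∉ K) (hy : y ∉ K) :
    x ∈ A ↔ y ∈ A := by
  rcases hA with h | h
  · exact iff_of_false (hx <| h ·) (hy <| h ·)
  · exact iff_of_true (not_not.1 (hx <| h ·)) (not_not.1 (hy <| h ·))

/-- The graph on the subsets of `E` whose edges are the pairs of crossing sets; pre-flowers and
crossing classes are connected in it. -/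
def crossingGraph (E : Type*) : SimpleGraph (Set E) where
  Adj := Crosses
  symm := ⟨fun _ _ => Crosses.symm⟩
  loopless := ⟨fun _ h => h (.inl subset_rfl)⟩

theorem preconnected_induce_iff {α : Type*} {G : SimpleGraph α} {s : Set α} :
    (G.induce s).Preconnected ↔ ∀ a ∈ s, ∀ b ∈ s,
      Relation.ReflTransGen (fun x y => x ∈ s ∧ y ∈ s ∧ G.Adj x y) a b := by
  constructor
  · intro h a ha b hb
    exact ((SimpleGraph.reachable_iff_reflTransGen ..).1 (h ⟨a, ha⟩ ⟨b, hb⟩)).lift Subtype.val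
      fun x y hxy => ⟨x.2, y.2, hxy⟩
  · rintro h ⟨a, ha⟩ ⟨b, hb⟩
    induction h a ha b hb with
    | refl => exact .refl _
    | tail _ hxy ih => exact (ih hxy.1).trans (SimpleGraph.Adj.reachable hxy.2.2)

theorem IsPreFlower.preconnected (hF : IsPreFlower 𝓑 F) :
    ((crossingGraph E).induce F).Preconnected :=
  (preconnected_induce_iff (G := crossingGraph E)).2 hF.2.2.2

theorem exists_crosses_of_toBoundary_ne (hF : ((crossingGraph E).induce F).Preconnected)
    {x y z w : E} (hx : x ∈ K) (hy : y ∈ K) (hz : z ∉ K) (hw : w ∉ K)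
    (hxy : toBoundary F x ≠ toBoundary F y) (hzw : toBoundary F z ≠ toBoundary F w) :
    ∃ R ∈ F, Crosses R K := by
  -- Otherwise each element of `F` has a side in `K` or in `Kᶜ`. As crossing elements of `F` agree
  -- on this, so do all of them, but `x`, `y` rule out `Kᶜ` and `z`, `w` rule out `K`.
  by_contra! hnested
  replace hnested : ∀ R ∈ F, HasSideIn R K ∨ HasSideIn R Kᶜ := fun R hR =>
    nested_iff_hasSideIn.1 (not_not.1 (hnested R hR))
  simp only [ne_eq, toBoundary_eq_iff, not_forall] at hxy hzw
  obtain ⟨S, hS, hxy⟩ := hxy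
  obtain ⟨T, hT, hzw⟩ := hzw
  have hSK : HasSideIn S K := (hnested S hS).resolve_right fun h =>
    hxy (h.mem_iff_mem (not_not.2 hx) (not_not.2 hy))
  have hasSideIn_of_chain : ∀ {R}, Relation.ReflTransGen
      (fun R R' => R ∈ F ∧ R' ∈ F ∧ Crosses R R') S R → HasSideIn R K := fun hSR => by
    induction hSR with
    | refl => exact hSK
    | tail _ hRR' ih => exact (hnested _ hRR'.2.1).resolve_right fun h => hRR'.2.2 (ih.nested h)
  exact hzw ((hasSideIn_of_chain (preconnected_induce_iff.1 hF S hS T hT)).mem_iff_mem hz hw)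

theorem crossingClass_subset (hV : V ∈ crossingClasses 𝓑) : V ⊆ 𝓑 := by
  obtain ⟨C, -, rfl⟩ := hV
  rintro _ ⟨S, -, rfl⟩
  exact S.2.1

theorem mem_crossingClass_of_crosses (hV : V ∈ crossingClasses 𝓑) (hS : S ∈ V) (hT : T ∈ 𝓑)
    (hST : Crosses S T) : T ∈ V := by
  obtain ⟨_, ⟨A, rfl⟩, rfl⟩ := hV
  obtain ⟨S, hSA, rfl⟩ := hS
  have hT' : T ∈ 𝓑 \ uncrossed 𝓑 := ⟨hT, fun h => hST.symm (h.2 S S.2.1)⟩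
  have hTS : crossingSetoid 𝓑 ⟨T, hT'⟩ S := fun r hr => hr _ _ hST.symm
  exact ⟨⟨T, hT'⟩, (crossingSetoid 𝓑).trans hTS hSA, rfl⟩

theorem exists_crosses_of_mem_crossingClasses (hV : V ∈ crossingClasses 𝓑) :
    ∃ S ∈ V, ∃ T ∈ V, Crosses S T := by
  obtain ⟨_, ⟨⟨S, hS⟩, rfl⟩, hVS⟩ := id hV
  have hSV : S ∈ V := hVS ▸ ⟨⟨S, hS⟩, (crossingSetoid 𝓑).refl _, rfl⟩
  obtain ⟨T, hT, hST⟩ : ∃ T ∈ 𝓑, Crosses S T := by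
    by_contra! h
    exact hS.2 ⟨hS.1, fun T hT => not_not.1 (h T hT)⟩
  exact ⟨S, hSV, T, mem_crossingClass_of_crosses hV hSV hT hST, hST⟩

theorem preconnected_crossingClass (hV : V ∈ crossingClasses 𝓑) :
    ((crossingGraph E).induce V).Preconnected := by
  let G := (crossingGraph E).induce (𝓑 \ uncrossed 𝓑)
  have reachable_of_rel : ∀ {A B}, crossingSetoid 𝓑 A B → G.Reachable A B := fun h =>
    h G.reachableSetoid fun A B hAB => SimpleGraph.Adj.reachable hAB
  have reachable_lift : ∀ {A B}, G.Reachable A B → ∀ hA : A.1 ∈ V,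
      ∃ hB : B.1 ∈ V, ((crossingGraph E).induce V).Reachable ⟨A, hA⟩ ⟨B, hB⟩ := by
    intro A B hAB hA
    rw [SimpleGraph.reachable_iff_reflTransGen] at hAB
    induction hAB with
    | refl => exact ⟨hA, .refl _⟩
    | @tail B B' _ hBB' ih =>
      obtain ⟨hB, hAB⟩ := ih
      exact ⟨mem_crossingClass_of_crosses hV hB B'.2.1 hBB',
        hAB.trans (SimpleGraph.Adj.reachable hBB')⟩
  rintro ⟨S, hS⟩ ⟨T, hT⟩
  obtain ⟨_, ⟨C, rfl⟩, hVC⟩ := id hV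
  obtain ⟨A, hAC, rfl⟩ := hVC ▸ hS
  obtain ⟨B, hBC, rfl⟩ := hVC ▸ hT
  have hAB := (crossingSetoid 𝓑).trans hAC ((crossingSetoid 𝓑).symm hBC)
  exact (reachable_lift (reachable_of_rel hAB) hS).2

theorem exists_preFlower (hV : V ∈ crossingClasses 𝓑) (G : Finset ↥V) :
    ∃ F ⊆ V, IsPreFlower 𝓑 F ∧ ∀ S ∈ G, (S : Set E) ∈ F := by
  classical
  obtain ⟨S, hS, T, hT, hST⟩ := exists_crosses_of_mem_crossingClasses hV
  obtain ⟨F, hGF, hF⟩ := (crossingGraph E |>.induce V).extend_finset_to_connected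
    (preconnected_crossingClass hV) (t := {⟨S, hS⟩, ⟨T, hT⟩} ∪ G) (by simp)
  have mem_image : ∀ {R : ↥V}, R ∈ ({⟨S, hS⟩, ⟨T, hT⟩} ∪ G : Finset ↥V) →
      (R : Set E) ∈ Subtype.val '' (F : Set ↥V) := fun hR => ⟨_, hGF hR, rfl⟩
  refine ⟨Subtype.val '' (F : Set ↥V), Subtype.coe_image_subset _ _,
    ⟨(Subtype.coe_image_subset _ _).trans (crossingClass_subset hV), F.finite_toSet.image _,
      ⟨S, mem_image (R := ⟨S, hS⟩) (by simp), T, mem_image (R := ⟨T, hT⟩) (by simp), ?_⟩,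
      (preconnected_induce_iff (G := crossingGraph E)).1 ?_⟩, fun R hR => mem_image (by simp [hR])⟩
  · rintro rfl
    exact hST (.inl subset_rfl)
  · refine hF.preconnected.map ⟨fun R => ⟨R.1.1, R.1, R.2, rfl⟩, id⟩ ?_
    rintro ⟨_, R, hR, rfl⟩
    exact ⟨⟨R, hR⟩, rfl⟩

end Crossing

section Limit

open Filter

variable {𝓑 F V : Set (Set E)} {x y z w : E}

theorem IsDaisyOrder.exists_crosses_of_alternating {c : CircularOrder ↥(boundary F)}
    (hc : IsDaisyOrder 𝓑 F c) (hF : ((crossingGraph E).induce F).Preconnected) {A : Set E}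
    (hx : x ∈ A) (hy : y ∈ A) (hz : z ∉ A) (hw : w ∉ A)
    (hxzy : sbtw (toBoundary F x) (toBoundary F z) (toBoundary F y))
    (hywx : sbtw (toBoundary F y) (toBoundary F w) (toBoundary F x)) :
    ∃ K ∈ 𝓑, Crosses A K ∧ ∃ R ∈ F, Crosses R K := by
  let K := toBoundary F ⁻¹' Set.cIoo (toBoundary F w) (toBoundary F y)
  have hxK : x ∈ K := hywx.cyclic_left
  have hzK : z ∈ K := hywx.cyclic_left.trans_left hxzy
  have hyK : y ∉ K := sbtw_irrefl_right
  have hwK : w ∉ K := sbtw_irrefl_left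
  refine ⟨K, (mem_sepClosure_iff.1 (hc.arc_mem_sepClosure hxK)).1, crosses_iff.2
    ⟨⟨y, hy, hyK⟩, ⟨x, hx, hxK⟩, ⟨z, hzK, hz⟩, ⟨w, fun h => h.elim hw hwK⟩⟩, ?_⟩
  exact exists_crosses_of_toBoundary_ne hF hxK hzK hyK hwK (sbtw_or_sbtw_iff.1 (.inl hxzy)).1
    (sbtw_or_sbtw_iff.1 (.inl hywx)).1

/-- The pre-daisies of `𝓑` that are contained in `V`; they approximate `∂(V)`. -/
def preDaisies (𝓑 V : Set (Set E)) : Set (Set (Set E)) := {F | F ⊆ V ∧ IsPreDaisy 𝓑 F}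

/-- The pre-daisies in `V` exhaust `V` along `l`: each element of `V` eventually belongs to them. -/
def Exhausts (l : Filter ↥(preDaisies 𝓑 V)) : Prop := ∀ A ∈ V, ∀ᶠ F in l, A ∈ F.1

theorem exists_ultrafilter_exhausts (hV : V ∈ crossingClasses 𝓑)
    (h_daisy : ∀ F ⊆ V, IsPreFlower 𝓑 F → IsPreDaisy 𝓑 F) :
    ∃ U : Ultrafilter ↥(preDaisies 𝓑 V), Exhausts (U : Filter ↥(preDaisies 𝓑 V)) := by
  choose F hFV hF hGF using exists_preFlower hV
  let f (G : Finset ↥V) : ↥(preDaisies 𝓑 V) := ⟨F G, hFV G, h_daisy _ (hFV G) (hF G)⟩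
  refine ⟨.of (atTop.map f), fun A hA => Ultrafilter.of_le _ (eventually_map.2 ?_)⟩
  filter_upwards [eventually_ge_atTop {⟨A, hA⟩}] with G hG
  exact hGF G _ (Finset.singleton_subset_iff.1 hG)

theorem Exhausts.eventually_toBoundary_ne {l : Filter ↥(preDaisies 𝓑 V)} (hl : Exhausts l)
    (hxy : toBoundary V x ≠ toBoundary V y) :
    ∀ᶠ F in l, toBoundary F.1 x ≠ toBoundary F.1 y := by
  simp only [ne_eq, toBoundary_eq_iff, not_forall] at hxy ⊢
  obtain ⟨A, hA, hxyA⟩ := hxy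
  exact (hl A hA).mono fun F hAF => ⟨A, hAF, hxyA⟩

theorem exists_displays (hV : ∀ S ∈ V, ∀ T ∈ 𝓑, Crosses S T → T ∈ V)
    {U : Ultrafilter ↥(preDaisies 𝓑 V)} (hU : Exhausts (U : Filter ↥(preDaisies 𝓑 V))) :
    ∃ c : CircularOrder ↥(boundary V), Displays 𝓑 V c := by
  have exists_order : ∀ F : ↥(preDaisies 𝓑 V), ∃ c, IsDaisyOrder 𝓑 F.1 c := fun F => F.2.2.2
  choose c hc using exists_order
  choose π hπ using fun F : ↥(preDaisies 𝓑 V) => exists_boundary_map F.2.1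
  have eventually_ne : ∀ P Q, P ≠ Q → ∀ᶠ F in U, π F P ≠ π F Q := by
    simp only [(toBoundary_surjective V).forall, hπ]
    exact fun _ _ => hU.eventually_toBoundary_ne
  refine ⟨ultralimitOrder U π eventually_ne, displays_iff.2 fun A hA x hx y hy z w hz hw => ?_⟩
  by_contra! hzw
  replace hz : ∀ᶠ F in U, sbtw (π F _) (π F _) (π F _) := hz
  replace hw : ∀ᶠ F in U, sbtw (π F _) (π F _) (π F _) := hw
  simp only [hπ] at hz hw
  have hAV : A ∈ V := by
    obtain ⟨F, hzF, hwF⟩ := (hz.and hw).exists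
    obtain ⟨K, hK, hAK, R, hR, hRK⟩ := (hc F).exists_crosses_of_alternating
      F.2.2.1.preconnected hx hy hzw.1 hzw.2 hzF hwF
    exact hV K (hV R (F.2.1 hR) K hK hRK) A (mem_sepClosure_iff.1 hA).1 hAK.symm
  obtain ⟨F, hzF, hwF, hAF⟩ := (hz.and (hw.and (hU A hAV))).exists
  exact (displays_iff.1 (hc F).displays A (subset_sepClosure F.2.2.1.1 hAF) x hx y hy z w hzF
    hwF).elim hzw.1 hzw.2

theorem Exhausts.eventually_sbtw_or_sbtw {l : Filter ↥(preDaisies 𝓑 V)} (hl : Exhausts l)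
    {c : CircularOrder ↥(boundary V)}
    (h : c.sbtw (toBoundary V x) (toBoundary V y) (toBoundary V z)) :
    ∀ᶠ F in l, ∀ _ : CircularOrder ↥(boundary F.1),
      sbtw (toBoundary F.1 x) (toBoundary F.1 y) (toBoundary F.1 z) ∨
      sbtw (toBoundary F.1 z) (toBoundary F.1 y) (toBoundary F.1 x) := by
  obtain ⟨hxy, hyz, hzx⟩ := sbtw_or_sbtw_iff.1 (.inl h)
  filter_upwards [hl.eventually_toBoundary_ne hxy, hl.eventually_toBoundary_ne hyz,
    hl.eventually_toBoundary_ne hzx] with F hxyF hyzF hzxF _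
  exact sbtw_or_sbtw_iff.2 ⟨hxyF, hyzF, hzxF⟩

variable {c c' : CircularOrder ↥(boundary V)}

theorem Displays.sbtw_of_sbtw {l : Filter ↥(preDaisies 𝓑 V)} [l.NeBot] (hl : Exhausts l)
    (hc : Displays 𝓑 V c) (hc' : Displays 𝓑 V c')
    {P Q R X Y Z : ↥(boundary V)} (hPQR : c.sbtw P Q R) (hPQR' : c'.sbtw P Q R)
    (hXYZ : c.sbtw X Y Z) : c'.sbtw X Y Z := by
  obtain ⟨p, rfl⟩ := toBoundary_surjective V P
  obtain ⟨q, rfl⟩ := toBoundary_surjective V Q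
  obtain ⟨r, rfl⟩ := toBoundary_surjective V R
  obtain ⟨x, rfl⟩ := toBoundary_surjective V X
  obtain ⟨y, rfl⟩ := toBoundary_surjective V Y
  obtain ⟨z, rfl⟩ := toBoundary_surjective V Z
  obtain ⟨F, hpqr, hxyz⟩ :=
    ((hl.eventually_sbtw_or_sbtw hPQR).and (hl.eventually_sbtw_or_sbtw hXYZ)).exists
  obtain ⟨hFV, -, cF, hF⟩ := F.2
  replace hF : IsDaisyOrder 𝓑 F cF := hF
  rcases hpqr cF with hpqr | hrqp <;> rcases hxyz cF with hxyz | hzyx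
  · exact hF.sbtw_of_displays hc' hFV hpqr hxyz hPQR'
  · exact (hF.not_sbtw_of_displays hc hFV hpqr hzyx hPQR hXYZ).elim
  · exact (hF.not_sbtw_of_displays hc hFV hxyz hrqp hXYZ hPQR).elim
  · exact (sbtw_or_reverse_of_sbtw c' hXYZ).resolve_right
      fun hZYX' => hF.not_sbtw_of_displays hc' hFV hzyx hrqp hZYX' hPQR'

theorem Displays.eq_or_eq_reverse {l : Filter ↥(preDaisies 𝓑 V)} [l.NeBot] (hl : Exhausts l)
    (hc : Displays 𝓑 V c) (hc' : Displays 𝓑 V c') :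
    (∀ P Q R, c'.sbtw P Q R ↔ c.sbtw P Q R) ∨ (∀ P Q R, c'.sbtw P Q R ↔ c.sbtw R Q P) := by
  by_cases h : ∃ P Q R, c.sbtw P Q R ∧ c'.sbtw P Q R
  · obtain ⟨P, Q, R, hPQR, hPQR'⟩ := h
    exact .inl fun X Y Z =>
      ⟨hc'.sbtw_of_sbtw hl hc hPQR' hPQR, hc.sbtw_of_sbtw hl hc' hPQR hPQR'⟩
  · push Not at h
    have reverse : ∀ {d d' : CircularOrder ↥(boundary V)},
        (∀ P Q R, d.sbtw P Q R → ¬ d'.sbtw P Q R) → ∀ {P Q R}, d.sbtw P Q R → d'.sbtw R Q P :=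
      fun {_ d'} h P Q R hPQR => (sbtw_or_reverse_of_sbtw d' hPQR).resolve_left (h P Q R hPQR)
    exact .inr fun P Q R => ⟨reverse fun X Y Z hc' hc => h X Y Z hc hc', reverse h⟩

end Limit

end BipartitionSystem

open BipartitionSystem in
theorem mainTheorem11_general {E : Type*} (𝓑 V : Set (Set E)) (hV : V ∈ crossingClasses 𝓑)
    (h_daisy : ∀ F ⊆ V, IsPreFlower 𝓑 F → IsPreDaisy 𝓑 F) :
    ∃ c : CircularOrder ↥(boundary V), Displays 𝓑 V c ∧
      ∀ c' : CircularOrder ↥(boundary V), Displays 𝓑 V c' →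
        (∀ P Q R, c'.sbtw P Q R ↔ c.sbtw P Q R) ∨ (∀ P Q R, c'.sbtw P Q R ↔ c.sbtw R Q P) := by
  obtain ⟨U, hU⟩ := exists_ultrafilter_exhausts hV h_daisy
  obtain ⟨c, hc⟩ := exists_displays (fun _ hS _ => mem_crossingClass_of_crosses hV hS) hU
  exact ⟨c, hc, fun _ hc' => hc.eq_or_eq_reverse hU hc'⟩

theorem mainTheorem11 {E : Type*} (𝓑 : Set (Set E))
    (h_nontrivial : ∀ S ∈ 𝓑, S ≠ ∅ ∧ S ≠ Set.univ)
    (h_compl : ∀ S ∈ 𝓑, Sᶜ ∈ 𝓑)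
    (h_union : ∀ S ∈ 𝓑, ∀ T ∈ 𝓑, BipartitionSystem.Crosses S T → S ∪ T ∈ 𝓑)
    (V : Set (Set E)) (hV : V ∈ BipartitionSystem.crossingClasses 𝓑)
    (h_daisy : ∀ F : Set (Set E), F ⊆ V → BipartitionSystem.IsPreFlower 𝓑 F →
      BipartitionSystem.IsPreDaisy 𝓑 F) :
    ∃ c : CircularOrder ↥(BipartitionSystem.boundary V),
      BipartitionSystem.Displays 𝓑 V c ∧
      ∀ c' : CircularOrder ↥(BipartitionSystem.boundary V),
        BipartitionSystem.Displays 𝓑 V c' →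
          (∀ P Q R, c'.sbtw P Q R ↔ c.sbtw P Q R) ∨
          (∀ P Q R, c'.sbtw P Q R ↔ c.sbtw R Q P) := by
  exact mainTheorem11_general 𝓑 V hV h_daisy
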